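/- Let $\mathbb P$ be a forcing poset (a preordered set, $p\le q$ meaning that $p$ is stronger; $p\parallel q$ means that $p,q$ have a common extension). For $A\subseteq\mathbb P$ let $A^{\not\perp}=\{p\in\mathbb P:\exists q\in A\; p\parallel q\}$; $B$ refines $A$ if every $p\in B$ satisfies $p\le q$ for some $q\in A$. A set $Q\subseteq\mathbb P$ is $\mathrm K$-linked if there is $Q'\subseteq\mathbb P$ such that (a) $Q\subseteq A^{\not\perp}$ for some finite $A\subseteq Q'$, and (b) whenever $A\subseteq Q'$ is finite with $Q\subseteq A^{\not\perp}$ and $D\subseteq\mathbb P$ is open dense, there is a finite $B\subseteq D\cap Q'$ refining $A$ with $Q\subseteq B^{\not\perp}$. $\mathbb P$ is $\sigma$-$\mathrm K$-linked if it is the union of countably many $\mathrm K$-linked sets. A predictor is a function $\sigma:\omega^{<\omega}\to\omega$; it constantly $\le$-predicts $x\in\omega^\omega$, written $x\sqsubset^{\mathrm{cp}}_{\le}\sigma$, if $\exists k\,\forall i\,\exists j\in[i,i+k)\; x(j)\le\sigma(x{\restriction}j)$; otherwise $x$ strongly evades $\sigma$. A family $F\subseteq\omega^\omega$ is unbounded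 if no single predictor constantly $\le$-predicts all members of $F$, and $\mathfrak e^{\mathsf{const}}_{\le}$ is the least size of an unbounded family. $\mathbb P$ is $\mathbf E^{\mathrm{cp}}_{\le}$-good if for every $\mathbb P$-name $\dot h$ for a predictor there is a nonempty countable set $H$ of ground-model predictors such that every ground-model $x\in\omega^\omega$ that strongly evades all members of $H$ satisfies $\Vdash x\not\sqsubset^{\mathrm{cp}}_{\le}\dot h$. **Lemma.** Let $\mathbb P$ be $\sigma$-$\mathrm K$-linked. Then: 1. $\mathbb P$ is $\mathbf E^{\mathrm{cp}}_{\le}$-good. 2. In fact, for every $\mathbb P$-name $\dot h$ for a predictor there is a single ground-model predictor $\psi$ such that every ground-model $x\in\omega^\omega$ that strongly evades $\psi$ satisfies $\Vdash x\not\sqsubset^{\mathrm{cp}}_{\le}\dot h$. 3. Consequently, every unbounded family $F\subseteq\omega^\omega$ of the ground model is forced by $\mathbb P$ to remain unbounded. In particular, there is a ground-model family of size $(\mathfrak e^{\mathsf{const}}_{\le})^V$ that is unbounded in the extension; so $\mathbb P$ forces $\mathfrak e^{\mathsf{const}}_{\le}\le|(\mathfrak e^{\mathsf{const}}_{\le})^V|$.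 -/

import Mathlib

/-! ### Predictors and constant `≤`-prediction on the Baire space -/

/-- A predictor on `ω^ω`: a function from finite sequences of naturals to the naturals. -/
abbrev Predictor : Type := List ℕ → ℕ

/-- The restriction `x ↾ j = (x 0, …, x (j - 1))`. -/
def restr (x : ℕ → ℕ) (j : ℕ) : List ℕ := (List.range j).map x

/-- `σ` constantly `≤`-predicts `x`. Its negation reads "`x` strongly evades `σ`". -/
def ConstPredictedLE (x : ℕ → ℕ) (σ : Predictor) : Prop :=
  ∃ k : ℕ, ∀ i : ℕ, ∃ j : ℕ, (i ≤ j ∧ j < i + k) ∧ x j ≤ σ (restr x j)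

/-- A family of reals is unbounded if no single predictor constantly `≤`-predicts all members. -/
def UnboundedFamily (F : Set (ℕ → ℕ)) : Prop :=
  ¬ ∃ σ : Predictor, ∀ x ∈ F, ConstPredictedLE x σ

/-- The cardinal `𝔢^const_≤`: the least size of an unbounded family. -/
noncomputable def eConstLE : Cardinal.{0} :=
  sInf {κ | ∃ F : Set (ℕ → ℕ), UnboundedFamily F ∧ Cardinal.mk F = κ}

/-! ### Posets; `p ≤ q` means that `p` is the stronger condition -/

section Posets

variable {P : Type*} [Preorder P]

/-- Compatibility `p ∥ q`. -/
def Compat (p q : P) : Prop := ∃ r, r ≤ p ∧ r ≤ q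

/-- `A^{⊥̸}`, the set of conditions compatible with some member of `A`. -/
def compatSet (A : Set P) : Set P := {p | ∃ q ∈ A, Compat p q}

/-- `B` refines `A`. -/
def Refines (B A : Set P) : Prop := ∀ p ∈ B, ∃ q ∈ A, p ≤ q

/-- Open dense subsets of a forcing poset. -/
def OpenDense (D : Set P) : Prop :=
  (∀ p ∈ D, ∀ q ≤ p, q ∈ D) ∧ ∀ p, ∃ q ∈ D, q ≤ p

/-- K-linked subsets of a poset. -/
def KLinked (Q : Set P) : Prop :=
  ∃ Q' : Set P,
    (∃ A ⊆ Q', A.Finite ∧ Q ⊆ compatSet A) ∧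
    ∀ A ⊆ Q', A.Finite → Q ⊆ compatSet A →
      ∀ D : Set P, OpenDense D →
        ∃ B ⊆ D ∩ Q', B.Finite ∧ Refines B A ∧ Q ⊆ compatSet B

end Posets

/-- `P` is σ-K-linked: a union of countably many K-linked subsets. -/
def SigmaKLinked (P : Type*) [Preorder P] : Prop :=
  ∃ Q : ℕ → Set P, (∀ n, KLinked (Q n)) ∧ ⋃ n, Q n = Set.univ

/-! ### The forcing relation

A sentence of the forcing language is represented by the predicate `p ↦ (p ⊩ φ)`; the clauses
below are the usual recursive clauses of the forcing relation. The quantifiers range over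
ground-model sets (bounded quantifiers over check names). -/

/-- Sentences of the forcing language, as predicates saying which conditions force them. -/
abbrev ForcingSentence (P : Type*) : Type _ := P → Prop

namespace ForcingSentence

variable {P : Type*} [Preorder P]

/-- The generic filter meets the ground-model set `S`: it is dense below `p` to lie below
a member of `S`. -/
def meets (S : Set P) : ForcingSentence P := fun p => ∀ q ≤ p, ∃ r ≤ q, ∃ a ∈ S, r ≤ a

/-- An absolute statement about ground-model objects. -/
def ground (φ : Prop) : ForcingSentence P := fun _ => φ

/-- Negation. -/
def not (φ : ForcingSentence P) : ForcingSentence P := fun p => ∀ q ≤ p, ¬ φ q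

/-- Conjunction. -/
def and (φ ψ : ForcingSentence P) : ForcingSentence P := fun p => φ p ∧ ψ p

/-- Universal quantification over a ground-model set. -/
def all {ι : Type*} (φ : ι → ForcingSentence P) : ForcingSentence P := fun p => ∀ i, φ i p

/-- Existential quantification over a ground-model set. -/
def ex {ι : Type*} (φ : ι → ForcingSentence P) : ForcingSentence P :=
  fun p => ∀ q ≤ p, ∃ r ≤ q, ∃ i, φ i r

/-- `⊩ φ`: every condition forces `φ`. -/
def Forced (φ : ForcingSentence P) : Prop := ∀ p, φ p

end ForcingSentence

/-- A `P`-name for a predictor: a set of pairs `((s, m)ˇ, p)`, given by its sections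
`{p | ((s, m)ˇ, p) ∈ name}`, which is forced to be a function from finite sequences of naturals
to naturals. -/
structure PredictorName (P : Type*) [Preorder P] where
  /-- The conditions that are attached to the pair `(s, m)` in the name. -/
  graph : List ℕ → ℕ → Set P
  forced_total : ForcingSentence.Forced
    (.all fun s : List ℕ => .ex fun m : ℕ => .meets (graph s m))
  forced_single : ForcingSentence.Forced
    (.all fun s : List ℕ => .all fun m : ℕ => .all fun m' : ℕ =>
      .not (.and (.ground (m ≠ m')) (.and (.meets (graph s m)) (.meets (graph s m')))))

namespace PredictorName

variable {P : Type*} [Preorder P]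

/-- The sentence `ḣ(s) = m`, that is, `(s, m) ∈ ḣ`. -/
def valueEq (h : PredictorName P) (s : List ℕ) (m : ℕ) : ForcingSentence P :=
  .meets (h.graph s m)

/-- For a ground-model real `x`, the sentence "`ḣ` constantly `≤`-predicts `x`". -/
def constPredictsLE (h : PredictorName P) (x : ℕ → ℕ) : ForcingSentence P :=
  .ex fun k : ℕ => .all fun i : ℕ => .ex fun j : ℕ => .and (.ground (i ≤ j ∧ j < i + k))
    (.ex fun m : ℕ => .and (h.valueEq (restr x j) m) (.ground (x j ≤ m)))

end PredictorName

/-! ### Goodness and preservation of unbounded families -/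

/-- `P` is `θ`-`E^cp_≤`-good, for the relational system
`E^cp_≤ = ⟨ω^ω, Predictor, ConstPredictedLE⟩`. -/
def ThetaEcpLEGood (θ : Cardinal.{0}) (P : Type*) [Preorder P] : Prop :=
  ∀ h : PredictorName P, ∃ H : Set Predictor, H.Nonempty ∧ Cardinal.mk H < θ ∧
    ∀ x : ℕ → ℕ, (∀ σ ∈ H, ¬ ConstPredictedLE x σ) →
      ForcingSentence.Forced (.not (h.constPredictsLE x))

/-- `P` is `E^cp_≤`-good, that is, `ℵ₁`-`E^cp_≤`-good. -/
def EcpLEGood (P : Type*) [Preorder P] : Prop := ThetaEcpLEGood (Cardinal.aleph 1) P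

/-- `P` forces the ground-model family `F` to be unbounded: whatever the name of a predictor, it
is forced that it does not constantly `≤`-predict all members of `F`. -/
def ForcedUnbounded (P : Type*) [Preorder P] (F : Set (ℕ → ℕ)) : Prop :=
  ∀ h : PredictorName P,
    ForcingSentence.Forced (.not (.all fun x : F => h.constPredictsLE (x : ℕ → ℕ)))

/-! Fix a K-linked `Q` and a name `h`. K-linkedness yields finite sets `A s`, refining one another
along the tree of finite sequences, such that each member of `A s` decides `h` at `s` and each
condition in `Q` is compatible with some member of `A s`. Let `σ s` bound the finitely many decided
values. If `q ∈ Q` forces prediction of `x` with constant `k`, make `q` compatible with a member of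
`A (restr x (i + k))`: by refinement it decides `h` along `x` throughout the window `[i, i + k)`, so
the true guess there is at most `σ`, which therefore predicts `x` with the same `k`. Countably many
such `σ`, one per piece of the poset, are absorbed into one `ψ`. -/

theorem restr_succ (x : ℕ → ℕ) (j : ℕ) : restr x (j + 1) = restr x j ++ [x j] := by
  simp [restr, List.range_succ]

@[simp]
theorem length_restr (x : ℕ → ℕ) (j : ℕ) : (restr x j).length = j := by
  simp [restr]

/-- Countably many predictors are dominated by a single one. -/
theorem exists_predictor_of_countable (σ : ℕ → Predictor) :
    ∃ ψ : Predictor, ∀ n x, ConstPredictedLE x (σ n) → ConstPredictedLE x ψ := by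
  -- A diagonal maximum: at `s` only the first `s.length + 1` predictors compete, so the supremum is
  -- finite and the `n`-th one takes part from length `n` on.
  refine ⟨fun s => (Finset.range (s.length + 1)).sup fun n => σ n s, ?_⟩
  rintro n x ⟨k, hk⟩
  -- The extra `n` pays for skipping the positions below `n`.
  refine ⟨n + k, fun i => ?_⟩
  obtain ⟨j, ⟨h₁, h₂⟩, hj⟩ := hk (max i n)
  refine ⟨j, by omega, hj.trans ?_⟩
  exact Finset.le_sup (f := fun n => σ n (restr x j)) (by simp; omega)

/-- The initial segments of a real whose every value exceeds the guess of `σ`. -/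
def evadingSegment (σ : Predictor) : ℕ → List ℕ
  | 0 => []
  | j + 1 => evadingSegment σ j ++ [σ (evadingSegment σ j) + 1]

theorem exists_not_constPredictedLE (σ : Predictor) : ∃ x, ¬ ConstPredictedLE x σ := by
  set x : ℕ → ℕ := fun j => σ (evadingSegment σ j) + 1 with hx
  have hr : ∀ j, restr x j = evadingSegment σ j := by
    intro j
    induction j with
    | zero => rfl
    | succ j ih => rw [restr_succ, ih]; rfl
  refine ⟨x, ?_⟩
  rintro ⟨k, hk⟩
  obtain ⟨j, -, hj⟩ := hk 0
  rw [hr] at hj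
  simp [hx] at hj

theorem unboundedFamily_univ : UnboundedFamily Set.univ := by
  rintro ⟨σ, hσ⟩
  obtain ⟨x, hx⟩ := exists_not_constPredictedLE σ
  exact hx (hσ x trivial)

/-- The cardinal `𝔢^const_≤` is attained. -/
theorem exists_unboundedFamily_mk_eq :
    ∃ F : Set (ℕ → ℕ), UnboundedFamily F ∧ Cardinal.mk F = eConstLE :=
  csInf_mem (s := {κ | ∃ F : Set (ℕ → ℕ), UnboundedFamily F ∧ Cardinal.mk F = κ})
    ⟨_, Set.univ, unboundedFamily_univ, rfl⟩

theorem Refines.trans {P : Type*} [Preorder P] {A B C : Set P} (h₁ : Refines A B)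
    (h₂ : Refines B C) : Refines A C := by
  intro p hp
  obtain ⟨q, hq, hpq⟩ := h₁ p hp
  obtain ⟨r, hr, hqr⟩ := h₂ q hq
  exact ⟨r, hr, hpq.trans hqr⟩

theorem Refines.refl {P : Type*} [Preorder P] (A : Set P) : Refines A A :=
  fun p hp => ⟨p, hp, le_rfl⟩

namespace PredictorName

variable {P : Type*} [Preorder P] (h : PredictorName P)

theorem valueEq_mono {s : List ℕ} {m : ℕ} {p q : P} (hqp : q ≤ p) (hp : h.valueEq s m p) :
    h.valueEq s m q :=
  fun r hr => hp r (hr.trans hqp)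

theorem valueEq_unique {s : List ℕ} {m m' : ℕ} {p : P} (hm : h.valueEq s m p)
    (hm' : h.valueEq s m' p) : m = m' := by
  by_contra hne
  exact h.forced_single p s m m' p le_rfl ⟨hne, hm, hm'⟩

theorem openDense_decides (s : List ℕ) : OpenDense {p | ∃ m, h.valueEq s m p} := by
  refine ⟨?_, fun p => ?_⟩
  · rintro p ⟨m, hm⟩ q hq
    exact ⟨m, h.valueEq_mono hq hm⟩
  · obtain ⟨r, hr, m, hm⟩ := h.forced_total p s p le_rfl
    exact ⟨r, ⟨m, hm⟩, hr⟩

end PredictorName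

/-- Along a K-linked set, any assignment of open dense sets to finite sequences is met by finite
covering sets that refine one another along the tree of finite sequences. -/
theorem KLinked.exists_refining_tree {P : Type*} [Preorder P] {Q : Set P} (hQ : KLinked Q)
    (D : List ℕ → Set P) (hD : ∀ s, OpenDense (D s)) :
    ∃ A : List ℕ → Set P, (∀ s, (A s).Finite) ∧ (∀ s, A s ⊆ D s) ∧ (∀ s, Q ⊆ compatSet (A s)) ∧
      ∀ s a, Refines (A (s ++ [a])) (A s) := by
  obtain ⟨Q', ⟨A₀, hA₀Q', hA₀, hQA₀⟩, hstep⟩ := hQ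
  let T := {A : Set P // A ⊆ Q' ∧ A.Finite ∧ Q ⊆ compatSet A}
  have key : ∀ (A : T) (s : List ℕ), ∃ B : T, B.1 ⊆ D s ∧ Refines B.1 A.1 := by
    rintro ⟨A, hAQ', hA, hQA⟩ s
    obtain ⟨B, hB, hBfin, hBA, hQB⟩ := hstep A hAQ' hA hQA (D s) (hD s)
    exact ⟨⟨B, fun p hp => (hB hp).2, hBfin, hQB⟩, fun p hp => (hB hp).1, hBA⟩
  choose next hnextD hnextR using key
  -- Sequences grow at the end while lists recurse at the head, so the tree is built on reversed
  -- sequences.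
  let g : List ℕ → T := fun l => List.rec (next ⟨A₀, hA₀Q', hA₀, hQA₀⟩ [])
    (fun a l A => next A (a :: l).reverse) l
  refine ⟨fun s => (g s.reverse).1, fun s => (g s.reverse).2.2.1, fun s => ?_,
    fun s => (g s.reverse).2.2.2, fun s a => ?_⟩
  · have hg : ∀ l, (g l).1 ⊆ D l.reverse
      | [] => hnextD _ _
      | a :: l => hnextD _ _
    simpa using hg s.reverse
  · beta_reduce
    rw [List.reverse_append]
    exact hnextR _ _

theorem refines_restr {P : Type*} [Preorder P] {A : List ℕ → Set P}
    (hA : ∀ s a, Refines (A (s ++ [a])) (A s)) (x : ℕ → ℕ) {i j : ℕ} (hij : i ≤ j) :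
    Refines (A (restr x j)) (A (restr x i)) := by
  induction j, hij using Nat.le_induction with
  | base => exact Refines.refl _
  | succ j _ ih => rw [restr_succ]; exact (hA _ _).trans ih

/-- A K-linked set admits a ground-model predictor that constantly `≤`-predicts every real which
some member of the set forces to be predicted, with a given constant, by the name. -/
theorem KLinked.exists_predictor {P : Type*} [Preorder P] {Q : Set P} (hQ : KLinked Q)
    (h : PredictorName P) :
    ∃ σ : Predictor, ∀ q ∈ Q, ∀ (x : ℕ → ℕ) (k : ℕ),
      (∀ i, ∀ r ≤ q, ∃ r' ≤ r, ∃ j, (i ≤ j ∧ j < i + k) ∧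
        ∃ m, h.valueEq (restr x j) m r' ∧ x j ≤ m) → ConstPredictedLE x σ := by
  obtain ⟨A, hfin, hdec, hcov, href⟩ :=
    hQ.exists_refining_tree (fun s => {p | ∃ m, h.valueEq s m p}) h.openDense_decides
  have hbound : ∀ s, ∃ M, ∀ a ∈ A s, ∃ m ≤ M, h.valueEq s m a := by
    intro s
    choose! v hv using fun a (ha : a ∈ A s) => hdec s ha
    obtain ⟨M, hM⟩ := ((hfin s).image v).bddAbove
    exact ⟨M, fun a ha => ⟨v a, hM ⟨a, ha, rfl⟩, hv a ha⟩⟩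
  choose σ hσ using hbound
  refine ⟨σ, fun q hq x k hk => ⟨k, fun i => ?_⟩⟩
  -- The position `j` is known only after `r` is extended, so `a` is taken at the end of the window,
  -- where it lies below a member of `A (restr x j)` for every possible `j`.
  obtain ⟨a, ha, r, hrq, hra⟩ := hcov (restr x (i + k)) hq
  obtain ⟨r', hr', j, hj, m, hm, hxm⟩ := hk i r hrq
  obtain ⟨b, hb, hab⟩ := refines_restr href x hj.2.le a ha
  obtain ⟨m', hm'M, hm'⟩ := hσ _ b hb
  have hmm' := h.valueEq_unique hm (h.valueEq_mono (hr'.trans (hra.trans hab)) hm')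
  exact ⟨j, hj, by omega⟩

/-- Over a σ-K-linked poset, a single ground-model predictor captures all ground-model reals that
a given name for a predictor may constantly `≤`-predict. -/
theorem SigmaKLinked.exists_predictor {P : Type*} [Preorder P] (hP : SigmaKLinked P)
    (h : PredictorName P) :
    ∃ ψ : Predictor, ∀ x : ℕ → ℕ, ¬ ConstPredictedLE x ψ →
      ForcingSentence.Forced (.not (h.constPredictsLE x)) := by
  obtain ⟨Q, hQ, hcover⟩ := hP
  choose σ hσ using fun n => (hQ n).exists_predictor h
  obtain ⟨ψ, hψ⟩ := exists_predictor_of_countable σ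
  refine ⟨ψ, fun x hx p q _ hpred => hx ?_⟩
  -- The constant must be decided before choosing the piece `Q n`, since it is the condition
  -- deciding it that has to lie in `Q n`.
  obtain ⟨r, -, k, hk⟩ := hpred q le_rfl
  obtain ⟨n, hn⟩ := Set.mem_iUnion.mp (hcover.symm ▸ Set.mem_univ r)
  refine hψ n x (hσ n r hn x k fun i t ht => ?_)
  obtain ⟨u, hut, j, hj, hex⟩ := hk i t ht
  obtain ⟨w, hwu, m, hm, hxm⟩ := hex u le_rfl
  exact ⟨w, hwu.trans hut, j, hj, m, hm, hxm⟩

theorem SigmaKLinked.forcedUnbounded {P : Type*} [Preorder P] (hP : SigmaKLinked P)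
    {F : Set (ℕ → ℕ)} (hF : UnboundedFamily F) : ForcedUnbounded P F := by
  intro h p q hqp hall
  obtain ⟨ψ, hψ⟩ := hP.exists_predictor h
  refine hF ⟨ψ, fun x hx => ?_⟩
  by_contra hxψ
  exact hψ x hxψ p q hqp (hall ⟨x, hx⟩)

theorem lemma5p16 {P : Type*} [Preorder P] (hP : SigmaKLinked P) :
    EcpLEGood P ∧
    (∀ h : PredictorName P, ∃ ψ : Predictor, ∀ x : ℕ → ℕ, ¬ ConstPredictedLE x ψ →
      ForcingSentence.Forced (.not (h.constPredictsLE x))) ∧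
    (∀ F : Set (ℕ → ℕ), UnboundedFamily F → ForcedUnbounded P F) ∧
    (∃ F : Set (ℕ → ℕ), Cardinal.mk F = eConstLE ∧ ForcedUnbounded P F) := by
  refine ⟨fun h => ?_, hP.exists_predictor, fun F => hP.forcedUnbounded, ?_⟩
  · obtain ⟨ψ, hψ⟩ := hP.exists_predictor h
    refine ⟨{ψ}, Set.singleton_nonempty ψ, ?_, fun x hx => hψ x (hx ψ rfl)⟩
    rw [Cardinal.mk_singleton]
    exact Cardinal.one_lt_aleph0.trans_le (Cardinal.aleph0_le_aleph 1)
  · obtain ⟨F, hF, hcard⟩ := exists_unboundedFamily_mk_eq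
    exact ⟨F, hcard, hP.forcedUnbounded hF⟩
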